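/- Let $R>0$ and let $\mathbb{T}^1_R=\mathbb{R}/R\mathbb{Z}$ be the torus of side $R$, with Lebesgue measure (of total mass $R$). Let $f,G\in H^1(\mathbb{T}^1_R)$ be real-valued with $\int_{\mathbb{T}^1_R}f=0$ and $\int_{\mathbb{T}^1_R}G=0$, with weak derivatives $f',G'\in L^2(\mathbb{T}^1_R)$; functions on the torus are also regarded as $R$-periodic functions on $\mathbb{R}$. Let $(b_s)_{s\ge 0}$ be a standard one-dimensional Brownian motion started at $0$, and let $r>0$, $t>0$. Then almost surely $s\mapsto f'(rb_s)$ is integrable on $[0,t]$, the random variable $G(b_t)\int_0^t f'(rb_s)\,ds$ is integrable, and the following hold. (i) With $f_r(x)=f(rx)$, so that $f_r'(x)=r f'(rx)$, $$\Big|\mathbb{E}\Big[G(b_t)\int_0^t f_r'(b_s)\,ds\Big]\Big|\le \frac{2R}{r}\,\|f\|_{L^2(\mathbb{T}^1_R)}\,\|G'\|_{L^2(\mathbb{T}^1_R)} .$$ (ii) If $r\ge 1$, then also $$\Big|\mathbb{E}\Big[G(b_t)\int_0^t f'(rb_s)\,ds\Big]\Big|\le \frac{2R}{r}\,\|f\|_{L^2(\mathbb{T}^1_R)}\,\|G'\|_{L^2(\mathbb{T}^1_R)}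 .$$ The bounds are uniform in $t$. For $R=1$ the right-hand sides are $2r^{-1}\|f\|_{L^2}\|G'\|_{L^2}$. -/

import Mathlib

open MeasureTheory ProbabilityTheory
open scoped NNReal

/-- `f` lies in the Sobolev space `H¹` of the one-dimensional torus `AddCircle R = ℝ / Rℤ` of side
`R`, and `f'` is (a representative of) its weak derivative: both functions are square integrable
for Lebesgue measure on the torus (of total mass `R`), and the integration by parts formula holds
against all smooth `R`-periodic test functions. -/
structure IsH1WithDeriv (R : ℝ) [Fact (0 < R)] (f f' : AddCircle R → ℝ) : Prop where
  memLp : MemLp f 2 volume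
  memLp_deriv : MemLp f' 2 volume
  integral_mul_deriv : ∀ φ : ℝ → ℝ, ContDiff ℝ (⊤ : ℕ∞) φ → Function.Periodic φ R →
    (∫ x in (0 : ℝ)..R, f (x : AddCircle R) * deriv φ x) =
      -(∫ x in (0 : ℝ)..R, f' (x : AddCircle R) * φ x)

/-- The norm of `L²(ℝ / Rℤ)` for Lebesgue measure, of total mass `R`. -/
noncomputable def torusL2Norm (R : ℝ) [Fact (0 < R)] (f : AddCircle R → ℝ) : ℝ :=
  (eLpNorm f 2 volume).toReal

/-! ### Fourier coefficients of Sobolev functions on the torus. -/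

section FourierSobolev

variable {R : ℝ} [hR : Fact (0 < R)]

/-! Expand `G` and `f'` in Fourier series. With u = 2πl/R and v = 2πkr/R, independence of increments
gives |E[exp(iu b_t) exp(iv b_s)]| = exp(-u²(t-s)/2 - (u+v)²s/2) for s ≤ t. One of |u|, |u+v| is at
least |v|/2, so the time integral is at most 8/v² = A/k² with A = 2R²/(π²r²), uniformly in t and l
(`norm_integral_fourier_brownian_le`). One factor 1/k pays for the derivative on `f`; the other
makes the sum over k converge by Cauchy–Schwarz. On the other side Ĝ(l) = R Ĝ'(l)/(2πil) is
absolutely summable in the same way, the mean-zero condition removing l = 0. The product of the two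
sums is 2R/(3r²) ‖f‖ ‖G'‖ (`abs_integral_mul_le_of_fourier_decay`). As `f'` is merely in L²,
termwise integration requires the law of r b_s on the torus, integrated over s, to be dominated by
Haar measure. The same decay at l = 0 yields this (`exists_le_smul_haar_of_summable_fourier`). -/

theorem hasSum_int_inv_sq : HasSum (fun k : ℤ => ((k : ℝ) ^ 2)⁻¹) (Real.pi ^ 2 / 3) := by
  have h := hasSum_zeta_two
  have h' : HasSum (fun n : ℕ => (((-(n : ℤ) : ℤ) : ℝ) ^ 2)⁻¹) (Real.pi ^ 2 / 6) := by
    simpa using h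
  have h2 := HasSum.of_nat_of_neg (f := fun k : ℤ => ((k : ℝ) ^ 2)⁻¹) (by simpa using h) h'
  -- The index 0 is counted in both halves; its term is 0 because 0⁻¹ = 0.
  have e : Real.pi ^ 2 / 3 = Real.pi ^ 2 / 6 + Real.pi ^ 2 / 6 - (((0 : ℤ) : ℝ) ^ 2)⁻¹ := by
    norm_num
    ring
  rw [e]
  exact h2

/-- Cauchy–Schwarz for a square summable family divided by its index. -/
theorem summable_norm_div_int {a : ℤ → ℝ} {S : ℝ} (ha : HasSum (fun k => a k ^ 2) S) :
    Summable (fun k : ℤ => |a k| * |(k : ℝ)|⁻¹) ∧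
      ∑' k : ℤ, |a k| * |(k : ℝ)|⁻¹ ≤ √S * (Real.pi / √3) := by
  have h := Real.summable_and_inner_le_Lp_mul_Lq_tsum_of_nonneg (p := 2) (q := 2)
    (f := fun k : ℤ => |a k|) (g := fun k : ℤ => |(k : ℝ)|⁻¹)
    (by constructor <;> norm_num) (fun _ => abs_nonneg _) (fun _ => by positivity)
    (by simpa using ha.summable) (by simpa using hasSum_int_inv_sq.summable)
  refine ⟨h.1, h.2.trans_eq ?_⟩
  simp only [Real.rpow_ofNat, sq_abs, inv_pow, ha.tsum_eq, hasSum_int_inv_sq.tsum_eq,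
    ← Real.sqrt_eq_rpow]
  rw [Real.sqrt_div (by positivity), Real.sqrt_sq Real.pi_pos.le]

theorem MeasureTheory.MemLp.ofReal_haarAddCircle {f : AddCircle R → ℝ} (hf : MemLp f 2 volume) :
    MemLp (fun x => (f x : ℂ)) 2 (AddCircle.haarAddCircle (T := R)) :=
  memLp_haarAddCircle_iff.2 hf.ofReal

theorem torusL2Norm_sq {f : AddCircle R → ℝ} (hf : MemLp f 2 volume) :
    torusL2Norm R f ^ 2 = ∫ x, ‖f x‖ ^ 2 := by
  have h0 : 0 ≤ ∫ x, ‖f x‖ ^ 2 := integral_nonneg fun x => by positivity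
  have h1 : torusL2Norm R f = (∫ x, ‖f x‖ ^ 2) ^ ((2 : ℝ)⁻¹) := by
    rw [torusL2Norm, hf.eLpNorm_eq_integral_rpow_norm two_ne_zero ENNReal.ofNat_ne_top,
      ENNReal.toReal_ofReal (by positivity)]
    simp only [ENNReal.toReal_ofNat, Real.rpow_ofNat]
  rw [h1, ← Real.rpow_mul_natCast h0]
  norm_num

/-- Parseval. The division by R converts Lebesgue measure into the normalized Haar measure that
defines the coefficients. -/
theorem hasSum_sq_fourierCoeff_of_memLp {f : AddCircle R → ℝ} (hf : MemLp f 2 volume) :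
    HasSum (fun k : ℤ => ‖fourierCoeff (fun x => (f x : ℂ)) k‖ ^ 2) (torusL2Norm R f ^ 2 / R) := by
  have hm : MemLp (fun x => (f x : ℂ)) 2 (AddCircle.haarAddCircle (T := R)) :=
    hf.ofReal_haarAddCircle
  have h := hasSum_sq_fourierCoeff (hm.toLp _)
  have he : fourierCoeff (hm.toLp _) = fourierCoeff (fun x => (f x : ℂ)) :=
    fourierCoeff_congr_ae hm.coeFn_toLp
  have h1 : ∫ x, ‖hm.toLp _ x‖ ^ 2 ∂AddCircle.haarAddCircle =
      ∫ x, ‖f x‖ ^ 2 ∂(AddCircle.haarAddCircle (T := R)) := by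
    refine integral_congr_ae ?_
    filter_upwards [hm.coeFn_toLp] with x hx
    rw [hx, Complex.norm_real]
  rw [he, h1, AddCircle.integral_haarAddCircle, ← torusL2Norm_sq hf, smul_eq_mul] at h
  rwa [div_eq_inv_mul]

theorem IsH1WithDeriv.fourierCoeff_deriv {f f' : AddCircle R → ℝ} (hf : IsH1WithDeriv R f f')
    (k : ℤ) : fourierCoeff (fun x => (f' x : ℂ)) k =
      2 * Real.pi * Complex.I * k / R * fourierCoeff (fun x => (f x : ℂ)) k := by
  set c : ℝ := 2 * Real.pi * k / R with hc
  have hR0 : R ≠ 0 := hR.out.ne'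
  have hint : ∀ {g : AddCircle R → ℝ}, MemLp g 2 volume →
      IntervalIntegrable (fun x : ℝ => g (x : AddCircle R)) volume 0 R := by
    intro g hg
    have := (AddCircle.measurePreserving_mk R 0).integrable_comp_of_integrable
      (hg.integrable (by norm_num))
    rw [zero_add] at this
    rw [intervalIntegrable_iff_integrableOn_Ioc_of_le hR.out.le]
    exact this
  have hper : ∀ x : ℝ, c * (x + R) = c * x + k * (2 * Real.pi) := by
    intro x; rw [hc]; field_simp
  -- Test functions are real, so the character is tested through its real and imaginary parts.
  have hcos := hf.integral_mul_deriv (fun x => Real.cos (c * x)) (by fun_prop)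
    (fun x => by simp only [hper, Real.cos_add_int_mul_two_pi])
  have hsin := hf.integral_mul_deriv (fun x => Real.sin (c * x)) (by fun_prop)
    (fun x => by simp only [hper, Real.sin_add_int_mul_two_pi])
  have hdcos : ∀ x, deriv (fun x => Real.cos (c * x)) x = -(c * Real.sin (c * x)) := fun x => by
    have := (((hasDerivAt_id x).const_mul c).cos).deriv
    simp [mul_comm]
  have hdsin : ∀ x, deriv (fun x => Real.sin (c * x)) x = c * Real.cos (c * x) := fun x => by
    have := (((hasDerivAt_id x).const_mul c).sin).deriv
    simp [mul_comm]
  simp only [hdcos] at hcos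
  simp only [hdsin] at hsin
  have key : ∀ {g : AddCircle R → ℝ}, MemLp g 2 volume →
      fourierCoeff (fun x => (g x : ℂ)) k = (1 / R : ℝ) •
        (((∫ x in (0 : ℝ)..R, g (x : AddCircle R) * Real.cos (c * x) : ℝ) : ℂ) -
        Complex.I * (∫ x in (0 : ℝ)..R, g (x : AddCircle R) * Real.sin (c * x) : ℝ)) := by
    intro g hg
    rw [fourierCoeff_eq_intervalIntegral _ _ 0, zero_add]
    congr 1
    rw [← intervalIntegral.integral_ofReal, ← intervalIntegral.integral_ofReal,
      ← intervalIntegral.integral_const_mul, ← intervalIntegral.integral_sub]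
    · refine intervalIntegral.integral_congr fun x _ => ?_
      have : (2 * Real.pi * Complex.I * ((-k : ℤ) : ℂ) * x / R : ℂ) =
          ((-(c * x) : ℝ) : ℂ) * Complex.I := by
        rw [hc]; push_cast; field_simp
      simp only [fourier_coe_apply, this, Complex.exp_mul_I, ← Complex.ofReal_cos,
        ← Complex.ofReal_sin, Real.cos_neg, Real.sin_neg, smul_eq_mul]
      push_cast
      ring
    · have h := (hint hg).mul_continuousOn (g := fun x => Real.cos (c * x)) (by fun_prop)
      exact ⟨h.1.ofReal, h.2.ofReal⟩
    · have h := (hint hg).mul_continuousOn (g := fun x => Real.sin (c * x)) (by fun_prop)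
      exact IntervalIntegrable.const_mul ⟨h.1.ofReal, h.2.ofReal⟩ _
  have e1 : (∫ x in (0 : ℝ)..R, f' (x : AddCircle R) * Real.cos (c * x)) =
      c * ∫ x in (0 : ℝ)..R, f (x : AddCircle R) * Real.sin (c * x) := by
    rw [← intervalIntegral.integral_const_mul, ← neg_inj, ← hcos,
      ← intervalIntegral.integral_neg]
    exact intervalIntegral.integral_congr fun x _ => by ring
  have e2 : (∫ x in (0 : ℝ)..R, f' (x : AddCircle R) * Real.sin (c * x)) =
      -(c * ∫ x in (0 : ℝ)..R, f (x : AddCircle R) * Real.cos (c * x)) := by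
    rw [← intervalIntegral.integral_const_mul, ← neg_inj, ← hsin, neg_neg]
    exact intervalIntegral.integral_congr fun x _ => by ring
  rw [key hf.memLp, key hf.memLp_deriv, e1, e2]
  have hcc : (2 * Real.pi * Complex.I * k / R : ℂ) = c * Complex.I := by
    rw [hc]; push_cast; ring
  rw [hcc]
  simp only [Complex.real_smul]
  push_cast
  linear_combination ((1 / (R : ℂ)) * c *
    ((∫ x in (0 : ℝ)..R, f (x : AddCircle R) * Real.sin (c * x) : ℝ) : ℂ)) * Complex.I_sq

/-- A square integrable function with absolutely summable Fourier coefficients agrees almost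
everywhere with the sum of its Fourier series. -/
theorem ae_hasSum_fourier_of_summable {g : AddCircle R → ℂ}
    (hg : MemLp g 2 (AddCircle.haarAddCircle (T := R)))
    (hs : Summable fun k => ‖fourierCoeff g k‖) :
    ∀ᵐ x ∂(AddCircle.haarAddCircle (T := R)),
      HasSum (fun k => fourierCoeff g k * fourier k x) (g x) := by
  have hsum : Summable fun k : ℤ => fourierCoeff g k • (fourier k : C(AddCircle R, ℂ)) := by
    refine .of_norm ?_
    simpa only [norm_smul, fourier_norm, mul_one] using hs
  obtain ⟨φ, hφ⟩ := hsum
  -- The uniform sum φ is also the L² sum of the series, hence equals g almost everywhere.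
  have h1 : HasSum (fun k : ℤ => fourierCoeff g k • fourierLp (T := R) 2 k)
      (ContinuousMap.toLp (E := ℂ) 2 AddCircle.haarAddCircle ℂ φ) := by
    have := hφ.mapL (ContinuousMap.toLp (E := ℂ) 2 (AddCircle.haarAddCircle (T := R)) ℂ)
    simpa only [map_smul] using this
  have h2 := hasSum_fourier_series_L2 hg.toLp
  have he : ∀ k, fourierCoeff hg.toLp k = fourierCoeff g k := fun k =>
    congrFun (fourierCoeff_congr_ae hg.coeFn_toLp) k
  simp_rw [he] at h2
  have h3 := h1.unique h2
  filter_upwards [hg.coeFn_toLp, ContinuousMap.coeFn_toLp (𝕜 := ℂ) (p := 2)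
    (AddCircle.haarAddCircle (T := R)) φ] with x hx hx'
  rw [← hx, ← h3, hx']
  exact ((ContinuousMap.evalCLM ℂ x).hasSum hφ)

end FourierSobolev

/-! ### Measures on the circle with summable Fourier coefficients. -/

section DensityOfSummableFourier

open Filter Topology

variable {R : ℝ} [hR : Fact (0 < R)]

theorem integral_fourier_mul_fourier_neg (n k : ℤ) :
    ∫ x, (fourier n x : ℂ) * fourier (-k) x ∂(AddCircle.haarAddCircle (T := R)) =
      if k = n then 1 else 0 := by
  have := congrFun (fourierCoeff_fourier (T := R) n) k
  rw [fourierCoeff, Pi.single_apply] at this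
  simpa only [smul_eq_mul, mul_comm] using this

/-- Integration against a finite measure on the circle, as a functional on continuous functions. -/
noncomputable def circleIntegralCLM (μ : Measure (AddCircle R)) [IsFiniteMeasure μ] :
    C(AddCircle R, ℂ) →L[ℂ] ℂ :=
  LinearMap.mkContinuous
    { toFun := fun φ => ∫ x, φ x ∂μ
      map_add' := fun φ ψ => integral_add
        (φ.continuous.integrable_of_hasCompactSupport (HasCompactSupport.of_compactSpace _))
        (ψ.continuous.integrable_of_hasCompactSupport (HasCompactSupport.of_compactSpace _))
      map_smul' := fun c φ => integral_const_mul c φ }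
    (μ.real Set.univ) fun φ => by
      rw [mul_comm]
      exact norm_integral_le_of_norm_le_const (ae_of_all _ φ.norm_coe_le_norm)

@[simp]
theorem circleIntegralCLM_apply (μ : Measure (AddCircle R)) [IsFiniteMeasure μ]
    (φ : C(AddCircle R, ℂ)) : circleIntegralCLM μ φ = ∫ x, φ x ∂μ := rfl

/-- A finite measure on the circle with absolutely summable Fourier coefficients has a continuous
density. -/
theorem exists_continuous_density_of_summable_fourier (μ : Measure (AddCircle R))
    [IsFiniteMeasure μ] (hμ : Summable fun k : ℤ => ‖∫ x, (fourier k x : ℂ) ∂μ‖) :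
    ∃ ρ : C(AddCircle R, ℂ), ∀ φ : C(AddCircle R, ℂ),
      ∫ x, φ x ∂μ = ∫ x, φ x * ρ x ∂AddCircle.haarAddCircle := by
  have hsum : Summable fun k : ℤ =>
      (∫ x, (fourier k x : ℂ) ∂μ) • (fourier (-k) : C(AddCircle R, ℂ)) := by
    refine .of_norm ?_
    simpa only [norm_smul, fourier_norm, mul_one] using hμ
  obtain ⟨ρ, hρ⟩ := hsum
  refine ⟨ρ, fun φ => ?_⟩
  -- Both sides are continuous functionals of φ, so it suffices to compare them on the characters,
  -- whose span is dense.
  suffices h : circleIntegralCLM μ = (circleIntegralCLM AddCircle.haarAddCircle).comp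
      ((ContinuousLinearMap.mul ℂ C(AddCircle R, ℂ)).flip ρ) from
    congrArg (fun L : C(AddCircle R, ℂ) →L[ℂ] ℂ => L φ) h
  refine ContinuousLinearMap.ext_on (s := Set.range fourier) ?_ ?_
  · exact Submodule.dense_iff_topologicalClosure_eq_top.2 span_fourier_closure_eq_top
  · rintro _ ⟨n, rfl⟩
    have h1 := ((circleIntegralCLM (AddCircle.haarAddCircle (T := R))).comp
      (ContinuousLinearMap.mul ℂ C(AddCircle R, ℂ) (fourier n))).hasSum hρ
    have h2 : ∀ k : ℤ, ((circleIntegralCLM (AddCircle.haarAddCircle (T := R))).comp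
        (ContinuousLinearMap.mul ℂ C(AddCircle R, ℂ) (fourier n)))
        ((∫ x, (fourier k x : ℂ) ∂μ) • (fourier (-k) : C(AddCircle R, ℂ))) =
        if k = n then ∫ x, (fourier n x : ℂ) ∂μ else 0 := fun k => by
      rw [map_smul]
      simp only [ContinuousLinearMap.comp_apply, ContinuousLinearMap.mul_apply',
        circleIntegralCLM_apply, ContinuousMap.mul_apply, integral_fourier_mul_fourier_neg,
        smul_eq_mul, mul_ite, mul_one, mul_zero]
      split_ifs with h
      · rw [h]
      · rfl
    have h3 := h1.unique (by
      simpa only [Function.comp_def, h2] using hasSum_ite_eq n (∫ x, (fourier n x : ℂ) ∂μ))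
    exact h3.symm

/-- A finite measure on the circle with absolutely summable Fourier coefficients is dominated by a
multiple of Haar measure. -/
theorem exists_le_smul_haar_of_summable_fourier (μ : Measure (AddCircle R))
    [IsFiniteMeasure μ] (hμ : Summable fun k : ℤ => ‖∫ x, (fourier k x : ℂ) ∂μ‖) :
    ∃ C : ℝ≥0, μ ≤ (C : ENNReal) • AddCircle.haarAddCircle := by
  obtain ⟨ρ, hρ⟩ := exists_continuous_density_of_summable_fourier μ hμ
  refine ⟨‖ρ‖₊, ?_⟩
  have hcont : ∀ g : C(AddCircle R, ℝ≥0), ∫⁻ x, (g x : ENNReal) ∂μ ≤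
      (‖ρ‖₊ : ENNReal) * ∫⁻ x, (g x : ENNReal) ∂AddCircle.haarAddCircle := by
    intro g
    have hg : Continuous fun x => (g x : ℝ) := by fun_prop
    have hint : ∀ (m : Measure (AddCircle R)) [IsFiniteMeasure m],
        Integrable (fun x => (g x : ℝ)) m := fun m _ =>
      hg.integrable_of_hasCompactSupport (HasCompactSupport.of_compactSpace _)
    have hlin : ∀ (m : Measure (AddCircle R)) [IsFiniteMeasure m],
        ∫⁻ x, (g x : ENNReal) ∂m = ENNReal.ofReal (∫ x, (g x : ℝ) ∂m) := fun m _ => by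
      rw [ofReal_integral_eq_lintegral_ofReal (hint m) (ae_of_all _ fun x => (g x).coe_nonneg)]
      simp only [ENNReal.ofReal_coe_nnreal]
    have hreal : ∫ x, (g x : ℝ) ∂μ ≤ ‖ρ‖ * ∫ x, (g x : ℝ) ∂AddCircle.haarAddCircle := by
      have h := hρ ⟨fun x => ((g x : ℝ) : ℂ), by fun_prop⟩
      simp only [ContinuousMap.coe_mk] at h
      calc ∫ x, (g x : ℝ) ∂μ ≤ ‖((∫ x, (g x : ℝ) ∂μ : ℝ) : ℂ)‖ := by
            rw [Complex.norm_real]; exact le_abs_self _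
        _ = ‖∫ x, ((g x : ℝ) : ℂ) * ρ x ∂AddCircle.haarAddCircle‖ := by
            rw [← h]; congr 1; exact integral_ofReal.symm
        _ ≤ ∫ x, ‖ρ‖ * (g x : ℝ) ∂AddCircle.haarAddCircle := by
            refine norm_integral_le_of_norm_le ((hint _).const_mul _) (ae_of_all _ fun x => ?_)
            rw [norm_mul, Complex.norm_real, Real.norm_of_nonneg (g x).coe_nonneg, mul_comm]
            exact mul_le_mul_of_nonneg_right (ρ.norm_coe_le_norm x) (g x).coe_nonneg
        _ = _ := integral_const_mul _ _
    rw [hlin, hlin, ← ENNReal.ofReal_coe_nnreal, coe_nnnorm, ← ENNReal.ofReal_mul (norm_nonneg _)]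
    exact ENNReal.ofReal_le_ofReal hreal
  -- Continuous thickened indicators decrease to that of a closed set; inner regularity then reaches
  -- all measurable sets.
  have hclosed : ∀ F : Set (AddCircle R), IsClosed F →
      μ F ≤ (‖ρ‖₊ : ENNReal) * AddCircle.haarAddCircle F := by
    intro F hF
    have hpos : ∀ n : ℕ, 0 < 1 / ((n : ℝ) + 1) := fun n => by positivity
    have hlim := tendsto_one_div_add_atTop_nhds_zero_nat (𝕜 := ℝ)
    exact le_of_tendsto_of_tendsto' (tendsto_lintegral_thickenedIndicator_of_isClosed μ hF hpos hlim)
      (ENNReal.Tendsto.const_mul (tendsto_lintegral_thickenedIndicator_of_isClosed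
        AddCircle.haarAddCircle hF hpos hlim) (Or.inr ENNReal.coe_ne_top))
      fun n => hcont (thickenedIndicator (hpos n) F).toContinuousMap
  refine Measure.le_iff.2 fun A hA => le_of_forall_lt fun c hc => ?_
  obtain ⟨F, hFA, hF, hcF⟩ := hA.exists_lt_isClosed_of_ne_top (measure_ne_top μ A) hc
  refine hcF.trans_le ((hclosed F hF).trans ?_)
  rw [Measure.smul_apply, smul_eq_mul]
  gcongr

end DensityOfSummableFourier

/-! ### The bilinear estimate under abstract Fourier decay. -/

section Pairing

variable {R : ℝ} [hR : Fact (0 < R)] {α : Type*} [MeasurableSpace α] {ν : Measure α}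
  {X Y : α → AddCircle R} {C : ℝ≥0}

theorem integrable_comp_of_map_le (hY : Measurable Y)
    (hC : ν.map Y ≤ (C : ENNReal) • AddCircle.haarAddCircle) {h : AddCircle R → ℂ}
    (hh : MemLp h 2 (AddCircle.haarAddCircle (T := R))) : Integrable (fun a => h (Y a)) ν := by
  have h1 : Integrable h (ν.map Y) :=
    (hh.integrable (by norm_num)).of_measure_le_smul ENNReal.coe_ne_top hC
  exact h1.comp_measurable hY

/-- Haar measure is a probability, so the L¹ norm is at most the L² norm. This makes composition
with `Y` a bounded functional on L². -/
theorem integral_norm_comp_le_of_map_le (hY : Measurable Y)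
    (hC : ν.map Y ≤ (C : ENNReal) • AddCircle.haarAddCircle)
    (h : Lp ℂ 2 (AddCircle.haarAddCircle (T := R))) :
    ∫ a, ‖h (Y a)‖ ∂ν ≤ C * ‖h‖ := by
  have hi : Integrable h (AddCircle.haarAddCircle (T := R)) := (Lp.memLp h).integrable (by norm_num)
  have h1 : Integrable h (ν.map Y) := hi.of_measure_le_smul ENNReal.coe_ne_top hC
  calc ∫ a, ‖h (Y a)‖ ∂ν = ∫ x, ‖h x‖ ∂(ν.map Y) :=
        (integral_map hY.aemeasurable h1.aestronglyMeasurable.norm).symm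
    _ ≤ ∫ x, ‖h x‖ ∂((C : ENNReal) • AddCircle.haarAddCircle (T := R)) :=
        integral_mono_measure hC (ae_of_all _ fun _ => norm_nonneg _)
          (hi.norm.smul_measure ENNReal.coe_ne_top)
    _ = C * ∫ x, ‖h x‖ ∂(AddCircle.haarAddCircle (T := R)) := by
        rw [integral_smul_measure, ENNReal.coe_toReal, smul_eq_mul]
    _ ≤ C * ‖h‖ := by
        gcongr
        rw [integral_norm_eq_lintegral_enorm hi.aestronglyMeasurable, Lp.norm_def,
          ← eLpNorm_one_eq_lintegral_enorm]
        exact ENNReal.toReal_mono (Lp.eLpNorm_ne_top h)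
          (eLpNorm_le_eLpNorm_of_exponent_le (by norm_num) hi.aestronglyMeasurable)

/-- The Fourier series of a square integrable function may be integrated termwise along a map whose
law is dominated by Haar measure, against a bounded weight. -/
theorem hasSum_integral_mul_fourier [IsFiniteMeasure ν] (hY : Measurable Y)
    (hC : ν.map Y ≤ (C : ENNReal) • AddCircle.haarAddCircle) {w : α → ℂ}
    (hw : AEStronglyMeasurable w ν) (hw1 : ∀ a, ‖w a‖ ≤ 1) {h : AddCircle R → ℂ}
    (hh : MemLp h 2 (AddCircle.haarAddCircle (T := R))) :
    HasSum (fun k => fourierCoeff h k * ∫ a, w a * fourier k (Y a) ∂ν)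
      (∫ a, w a * h (Y a) ∂ν) := by
  have hq : Measure.QuasiMeasurePreserving Y ν (AddCircle.haarAddCircle (T := R)) :=
    ⟨hY, Measure.absolutelyContinuous_of_le_smul hC⟩
  have hi : ∀ g : Lp ℂ 2 (AddCircle.haarAddCircle (T := R)),
      Integrable (fun a => w a * g (Y a)) ν := fun g =>
    (integrable_comp_of_map_le hY hC (Lp.memLp g)).bdd_mul hw (ae_of_all _ hw1)
  -- A bounded functional on L² may be applied termwise to the L²-convergent Fourier series.
  let L : Lp ℂ 2 (AddCircle.haarAddCircle (T := R)) →L[ℂ] ℂ := LinearMap.mkContinuous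
    { toFun := fun g => ∫ a, w a * g (Y a) ∂ν
      map_add' := fun g₁ g₂ => by
        rw [← integral_add (hi g₁) (hi g₂)]
        refine integral_congr_ae ?_
        filter_upwards [hq.ae (Lp.coeFn_add g₁ g₂)] with a ha
        rw [ha, Pi.add_apply, mul_add]
      map_smul' := fun c g => by
        rw [RingHom.id_apply, smul_eq_mul, ← integral_const_mul]
        refine integral_congr_ae ?_
        filter_upwards [hq.ae (Lp.coeFn_smul c g)] with a ha
        rw [ha, Pi.smul_apply, smul_eq_mul, mul_left_comm] } C fun g => by
      refine (norm_integral_le_of_norm_le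
        (integrable_comp_of_map_le hY hC (Lp.memLp g)).norm (ae_of_all _ fun a => ?_)).trans
        (integral_norm_comp_le_of_map_le hY hC g)
      rw [norm_mul]
      exact mul_le_of_le_one_left (norm_nonneg _) (hw1 a)
  have hL := L.hasSum (hasSum_fourier_series_L2 (hh.toLp _))
  have e1 : L (hh.toLp _) = ∫ a, w a * h (Y a) ∂ν := by
    refine integral_congr_ae ?_
    filter_upwards [hq.ae hh.coeFn_toLp] with a ha
    rw [ha]
  have e2 : ∀ k, L (fourierCoeff (hh.toLp _) k • fourierLp 2 k) =
      fourierCoeff h k * ∫ a, w a * fourier k (Y a) ∂ν := fun k => by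
    rw [map_smul, smul_eq_mul, fourierCoeff_congr_ae hh.coeFn_toLp]
    congr 1
    refine integral_congr_ae ?_
    filter_upwards [hq.ae (coeFn_fourierLp 2 k)] with a ha
    rw [ha]
  simpa only [Function.comp_def, e1, e2] using hL

/-- Integration of a product `g (X a) * h (Y a)`, where `g` has an absolutely convergent Fourier
series and `h (Y a)` is integrable. -/
theorem hasSum_integral_fourier_mul [IsFiniteMeasure ν] (hX : Measurable X)
    (hXac : ν.map X ≪ AddCircle.haarAddCircle) {g : AddCircle R → ℂ}
    (hg : MemLp g 2 (AddCircle.haarAddCircle (T := R)))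
    (hs : Summable fun k => ‖fourierCoeff g k‖) {H : α → ℂ} (hH : Integrable H ν) :
    Integrable (fun a => g (X a) * H a) ν ∧
    HasSum (fun l => fourierCoeff g l * ∫ a, fourier l (X a) * H a ∂ν)
      (∫ a, g (X a) * H a ∂ν) := by
  have hq : Measure.QuasiMeasurePreserving X ν (AddCircle.haarAddCircle (T := R)) := ⟨hX, hXac⟩
  have hae := hq.ae (ae_hasSum_fourier_of_summable hg hs)
  have hn : ∀ (l : ℤ) (x : AddCircle R), ‖(fourier l x : ℂ)‖ = 1 := fun l x => by
    rw [fourier_apply]; exact Circle.norm_coe _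
  have hfm : ∀ l : ℤ, Measurable fun a => (fourier l (X a) : ℂ) := fun l =>
    (fourier l).continuous.measurable.comp hX
  have hterm : ∀ l : ℤ, Integrable (fun a => (fourier l (X a) : ℂ) * H a) ν := fun l =>
    hH.bdd_mul (hfm l).aestronglyMeasurable (ae_of_all _ fun a => (hn l _).le)
  constructor
  · refine hH.bdd_mul (c := ∑' l, ‖fourierCoeff g l‖)
      (hg.aestronglyMeasurable.comp_quasiMeasurePreserving hq) ?_
    filter_upwards [hae] with a ha
    rw [← ha.tsum_eq]
    refine tsum_of_norm_bounded hs.hasSum fun l => ?_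
    rw [norm_mul, hn, mul_one]
  · let F : ℤ → α → ℂ := fun l a => fourierCoeff g l * ((fourier l (X a) : ℂ) * H a)
    have hF : ∀ l, Integrable (F l) ν := fun l => (hterm l).const_mul _
    have hFn : ∀ l, ∫ a, ‖F l a‖ ∂ν = ‖fourierCoeff g l‖ * ∫ a, ‖H a‖ ∂ν := fun l => by
      simp only [F, norm_mul, hn, one_mul]
      exact integral_const_mul _ _
    have h := hasSum_integral_of_summable_integral_norm hF (by
      simp only [hFn]
      exact hs.mul_right _)
    simp only [F, integral_const_mul] at h
    have e : ∫ a, g (X a) * H a ∂ν =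
        ∫ a, ∑' l, fourierCoeff g l * ((fourier l (X a) : ℂ) * H a) ∂ν := by
      refine integral_congr_ae ?_
      filter_upwards [hae] with a ha
      rw [← (ha.mul_right (H a)).tsum_eq]
      simp only [mul_assoc]
    rw [e]
    exact h

/-- The bilinear estimate: if the mixed Fourier coefficients of `(X, Y)` decay quadratically in the
second frequency, then `∫ G (X) f' (Y)` is bounded in terms of `‖f‖` and `‖G'‖`. -/
theorem abs_integral_mul_le_of_fourier_decay [IsFiniteMeasure ν] (hX : Measurable X) (hY : Measurable Y)
    (hXac : ν.map X ≪ AddCircle.haarAddCircle) {A : ℝ} (hA : 0 ≤ A)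
    (hdecay : ∀ l k : ℤ, k ≠ 0 →
      ‖∫ a, (fourier l (X a) : ℂ) * fourier k (Y a) ∂ν‖ ≤ A * ((k : ℝ) ^ 2)⁻¹)
    {f f' G G' : AddCircle R → ℝ} (hf : IsH1WithDeriv R f f') (hG : IsH1WithDeriv R G G')
    (hG0 : (∫ x, G x) = 0) :
    Integrable (fun a => f' (Y a)) ν ∧ Integrable (fun a => G (X a) * f' (Y a)) ν ∧
    |∫ a, G (X a) * f' (Y a) ∂ν| ≤
      A * Real.pi ^ 2 / (3 * R) * torusL2Norm R f * torusL2Norm R G' := by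
  have hR0 := hR.out
  have hpi := Real.pi_pos
  have hn : ∀ (l : ℤ) (x : AddCircle R), ‖(fourier l x : ℂ)‖ = 1 := fun l x => by
    rw [fourier_apply]; exact Circle.norm_coe _
  obtain ⟨C, hC⟩ : ∃ C : ℝ≥0, ν.map Y ≤ (C : ENNReal) • AddCircle.haarAddCircle := by
    -- The decay hypothesis at l = 0 bounds the Fourier coefficients of the law of `Y`; k = 0 is a
    -- single exceptional index.
    refine exists_le_smul_haar_of_summable_fourier _ ?_
    refine Summable.of_norm_bounded_eventually
      (g := fun k : ℤ => A * ((k : ℝ) ^ 2)⁻¹) (hasSum_int_inv_sq.summable.mul_left A) ?_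
    refine (Set.finite_singleton (0 : ℤ)).subset fun k hk => ?_
    by_contra hk0
    refine hk ?_
    have := hdecay 0 k hk0
    simp only [fourier_zero, one_mul] at this
    rwa [Set.mem_ofPred_eq, norm_norm, integral_map hY.aemeasurable
      (fourier k).continuous.aestronglyMeasurable]
  have hf'm := hf.memLp_deriv.ofReal_haarAddCircle
  have hH : Integrable (fun a => (f' (Y a) : ℂ)) ν := integrable_comp_of_map_le hY hC hf'm
  obtain ⟨hfs, hfb⟩ := summable_norm_div_int (hasSum_sq_fourierCoeff_of_memLp hf.memLp)
  obtain ⟨hGs, hGb⟩ := summable_norm_div_int (hasSum_sq_fourierCoeff_of_memLp hG.memLp_deriv)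
  simp only [abs_norm] at hfs hfb hGs hGb
  have hG00 : fourierCoeff (fun x => (G x : ℂ)) 0 = 0 := by
    rw [fourierCoeff, AddCircle.integral_haarAddCircle]
    simp only [neg_zero, fourier_zero, one_smul]
    rw [integral_complex_ofReal, hG0]
    simp
  have hGl : ∀ l : ℤ, ‖fourierCoeff (fun x => (G x : ℂ)) l‖ =
      R / (2 * Real.pi) * (‖fourierCoeff (fun x => (G' x : ℂ)) l‖ * |(l : ℝ)|⁻¹) := by
    intro l
    by_cases hl : l = 0
    · simp [hl, hG00]
    · have : |(l : ℝ)| ≠ 0 := by simpa using hl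
      rw [hG.fourierCoeff_deriv]
      simp only [norm_mul, norm_div, Complex.norm_real, Complex.norm_I, Complex.norm_intCast,
        Complex.norm_ofNat, Real.norm_of_nonneg hpi.le, Real.norm_of_nonneg hR0.le]
      field_simp
  have hGsum : Summable fun l => ‖fourierCoeff (fun x => (G x : ℂ)) l‖ := by
    simp only [hGl]
    exact hGs.mul_left _
  -- Here |f̂'(k)| A/k² = (2π|k|/R) |f̂(k)| A/k²; the resulting bound does not depend on l.
  set B : ℝ := 2 * Real.pi * A / R *
    ∑' k : ℤ, ‖fourierCoeff (fun x => (f x : ℂ)) k‖ * |(k : ℝ)|⁻¹ with hB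
  have hBl : ∀ l : ℤ, ‖∫ a, (fourier l (X a) : ℂ) * f' (Y a) ∂ν‖ ≤ B := by
    intro l
    have hsum := hasSum_integral_mul_fourier hY hC (w := fun a => (fourier l (X a) : ℂ))
      ((fourier l).continuous.measurable.comp hX).aestronglyMeasurable
      (fun a => (hn l _).le) hf'm
    rw [← hsum.tsum_eq]
    refine tsum_of_norm_bounded (hfs.hasSum.mul_left _) fun k => ?_
    rw [norm_mul, hf.fourierCoeff_deriv]
    simp only [norm_mul, norm_div, Complex.norm_real, Complex.norm_I, Complex.norm_intCast,
      Complex.norm_ofNat, Real.norm_of_nonneg hpi.le, Real.norm_of_nonneg hR0.le]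
    by_cases hk : k = 0
    · simp [hk]
    · have hk' : 0 < |(k : ℝ)| := by simpa using hk
      refine (mul_le_mul_of_nonneg_left (hdecay l k hk) (by positivity)).trans_eq ?_
      rw [← sq_abs (k : ℝ)]
      field_simp
  obtain ⟨hint, hsum⟩ := hasSum_integral_fourier_mul hX hXac hG.memLp.ofReal_haarAddCircle hGsum hH
  refine ⟨by simpa using hH.re, by simpa using hint.re, ?_⟩
  have hnorm : |∫ a, G (X a) * f' (Y a) ∂ν| = ‖∫ a, (G (X a) : ℂ) * f' (Y a) ∂ν‖ := by
    rw [← Real.norm_eq_abs, ← Complex.norm_real, ← integral_complex_ofReal]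
    simp only [Complex.ofReal_mul]
  have hB0 : 0 ≤ B := (norm_nonneg _).trans (hBl 0)
  have hfin : ‖∫ a, (G (X a) : ℂ) * f' (Y a) ∂ν‖ ≤
      (∑' l, ‖fourierCoeff (fun x => (G x : ℂ)) l‖) * B := by
    rw [← hsum.tsum_eq]
    refine tsum_of_norm_bounded (hGsum.hasSum.mul_right _) fun l => ?_
    rw [norm_mul]
    exact mul_le_mul_of_nonneg_left (hBl l) (norm_nonneg _)
  have h3 : √(3 : ℝ) ^ 2 = 3 := Real.sq_sqrt (by norm_num)
  have hsR : √R ^ 2 = R := Real.sq_sqrt hR0.le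
  have hnn : ∀ g : AddCircle R → ℝ, 0 ≤ torusL2Norm R g := fun g => ENNReal.toReal_nonneg
  have hsqrt : ∀ g : AddCircle R → ℝ, √(torusL2Norm R g ^ 2 / R) = torusL2Norm R g / √R :=
    fun g => by rw [Real.sqrt_div (by positivity), Real.sqrt_sq (hnn g)]
  rw [hsqrt] at hfb hGb
  have hs3 : 0 < √(3 : ℝ) := by positivity
  have hsRp : 0 < √R := by positivity
  rw [hnorm]
  refine hfin.trans ?_
  simp only [hGl, tsum_mul_left]
  -- Each Cauchy–Schwarz contributes 1/√R from Parseval and π/√3 = √(∑ 1/k²).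
  calc _ ≤ R / (2 * Real.pi) * (torusL2Norm R G' / √R * (Real.pi / √3)) *
        (2 * Real.pi * A / R * (torusL2Norm R f / √R * (Real.pi / √3))) := by
        have := hnn G'
        rw [hB]
        gcongr
    _ = A * Real.pi ^ 2 / (√3 ^ 2 * √R ^ 2) * torusL2Norm R f * torusL2Norm R G' := by
        field_simp
    _ = _ := by rw [h3, hsR]

end Pairing

/-! ### Null sets under the projection to the torus. -/

section CircleProjection

theorem AddCircle.quasiMeasurePreserving_coe {R : ℝ} [hR : Fact (0 < R)] :
    Measure.QuasiMeasurePreserving (fun x : ℝ => (x : AddCircle R)) volume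
      (AddCircle.haarAddCircle (T := R)) := by
  refine ⟨AddCircle.measurable_mk', Measure.AbsolutelyContinuous.mk fun N hN hN0 => ?_⟩
  rw [Measure.map_apply AddCircle.measurable_mk' hN]
  have hN1 : volume N = 0 := by
    rw [AddCircle.volume_eq_smul_haarAddCircle, Measure.smul_apply, hN0, smul_zero]
  have hcover := iUnion_Ioc_add_zsmul hR.out (0 : ℝ)
  rw [← Set.inter_univ ((fun x : ℝ => (x : AddCircle R)) ⁻¹' N), ← hcover, Set.inter_iUnion]
  refine measure_iUnion_null fun n => ?_
  have h := (AddCircle.measurePreserving_mk R (0 + n • R)).measure_preimage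
    hN.nullMeasurableSet
  rw [Measure.restrict_apply (AddCircle.measurable_mk' hN), hN1] at h
  rwa [add_zsmul, one_zsmul, ← add_assoc]

end CircleProjection

/-! ### Brownian characteristic functions and regular versions. -/

section Brownian

variable {Ω : Type*} [MeasurableSpace Ω] {P : Measure Ω}

theorem integral_exp_of_hasLaw_gaussianReal {Z : Ω → ℝ} {v : ℝ≥0}
    (hZ : HasLaw Z (gaussianReal 0 v) P) (u : ℝ) :
    ∫ ω, Complex.exp (u * Z ω * Complex.I) ∂P = (Real.exp (-(v * u ^ 2 / 2)) : ℝ) := by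
  have h := hZ.integral_comp (f := fun x : ℝ => Complex.exp (u * x * Complex.I))
    (Continuous.aestronglyMeasurable (by fun_prop))
  rw [← charFun_apply_real, charFun_gaussianReal] at h
  rw [← Function.comp_def (fun x : ℝ => Complex.exp (u * x * Complex.I)) Z, h]
  push_cast
  congr 1
  ring

/-- The characteristic function of the Brownian motion at two times. -/
theorem ProbabilityTheory.IsPreBrownianReal.norm_integral_exp {b : ℝ≥0 → Ω → ℝ}
    (hb : IsPreBrownianReal b P) {s t : ℝ≥0} (hst : s ≤ t) (u v : ℝ) :
    ‖∫ ω, Complex.exp (u * b t ω * Complex.I) * Complex.exp (v * b s ω * Complex.I) ∂P‖ =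
      Real.exp (-(u ^ 2 / 2 * (t - s) + (u + v) ^ 2 / 2 * s)) := by
  -- The exponent u b_t + v b_s splits as (u+v) b_s + u (b_t - b_s), a sum of independent Gaussians.
  have hind := hb.hasIndepIncrements.indepFun_eval_sub zero_le hst hb.eval_zero_ae_eq_zero
  have hexp : ∀ c : ℝ, Measurable fun x : ℝ => Complex.exp (c * x * Complex.I) := fun c =>
    Continuous.measurable (by fun_prop)
  have hind' := hind.comp (hexp (u + v)) (hexp u)
  have hlaw := hb.hasLaw_sub t s
  have h1 := integral_exp_of_hasLaw_gaussianReal (hb.hasLaw_eval s) (u + v)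
  have h2 := integral_exp_of_hasLaw_gaussianReal hlaw u
  have hfac : ∀ ω, Complex.exp (u * b t ω * Complex.I) * Complex.exp (v * b s ω * Complex.I) =
      Complex.exp ((u + v : ℝ) * b s ω * Complex.I) *
        Complex.exp (u * (b t - b s) ω * Complex.I) := fun ω => by
    rw [← Complex.exp_add, ← Complex.exp_add, Pi.sub_apply]
    congr 1
    push_cast
    ring
  have h3 := hind'.integral_fun_mul_eq_mul_integral
    ((hexp _).comp_aemeasurable (hb.aemeasurable s)).aestronglyMeasurable
    ((hexp _).comp_aemeasurable hlaw.aemeasurable).aestronglyMeasurable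
  simp only [Function.comp_apply] at h3
  simp only [hfac]
  rw [h3, h1, h2, ← Complex.ofReal_mul, Complex.norm_real, ← Real.exp_add,
    Real.norm_of_nonneg (Real.exp_nonneg _)]
  have hd : ((nndist (t : ℝ) (s : ℝ) : ℝ≥0) : ℝ) = t - s := by
    rw [coe_nndist, Real.dist_eq, abs_of_nonneg (sub_nonneg.2 (NNReal.coe_le_coe.2 hst))]
  congr 1
  change -(_) + -(((nndist (t : ℝ) (s : ℝ) : ℝ≥0) : ℝ) * u ^ 2 / 2) = _
  rw [hd]
  ring

theorem integral_exp_neg_mul_le {m : ℝ} (hm : 0 < m) (t : ℝ) :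
    ∫ s in (0 : ℝ)..t, Real.exp (-(m * s)) ≤ m⁻¹ := by
  have h : ∀ s ∈ Set.uIcc 0 t,
      HasDerivAt (fun s => -(m⁻¹ * Real.exp (-(m * s)))) (Real.exp (-(m * s))) s := fun s _ => by
    have := ((((hasDerivAt_id s).const_mul m).neg).exp.const_mul m⁻¹).neg
    have e : Real.exp (-(m * s)) = -(m⁻¹ * (Real.exp (-(m * s)) * -(m * 1))) := by field_simp
    rw [e]
    exact this
  rw [intervalIntegral.integral_eq_sub_of_hasDerivAt h
    (Continuous.intervalIntegrable (by fun_prop) _ _)]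
  have : 0 ≤ m⁻¹ * Real.exp (-(m * t)) := by positivity
  simp
  linarith

/-- Dropping one nonnegative term leaves decay at rate m away from one endpoint, whence a bound free
of t. -/
theorem integral_exp_neg_add_le {p q m t : ℝ} (hp : 0 ≤ p) (hq : 0 ≤ q) (hm : 0 < m)
    (ht : 0 ≤ t) (h : m ≤ p ∨ m ≤ q) :
    ∫ s in (0 : ℝ)..t, Real.exp (-(p * (t - s) + q * s)) ≤ m⁻¹ := by
  rcases h with h | h
  · calc _ ≤ ∫ s in (0 : ℝ)..t, Real.exp (-(m * (t - s))) := by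
          refine intervalIntegral.integral_mono_on ht
            (Continuous.intervalIntegrable (by fun_prop) _ _)
            (Continuous.intervalIntegrable (by fun_prop) _ _) fun s hs => ?_
          have := mul_le_mul_of_nonneg_right h (sub_nonneg.2 hs.2)
          have := mul_nonneg hq hs.1
          exact Real.exp_le_exp.2 (by linarith)
      _ = ∫ s in (0 : ℝ)..t, Real.exp (-(m * s)) := by
          rw [intervalIntegral.integral_comp_sub_left (fun s => Real.exp (-(m * s))) t]
          simp
      _ ≤ _ := integral_exp_neg_mul_le hm t
  · refine le_trans ?_ (integral_exp_neg_mul_le hm t)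
    refine intervalIntegral.integral_mono_on ht
      (Continuous.intervalIntegrable (by fun_prop) _ _)
      (Continuous.intervalIntegrable (by fun_prop) _ _) fun s hs => ?_
    have := mul_le_mul_of_nonneg_right h hs.1
    have := mul_nonneg hp (sub_nonneg.2 hs.2)
    exact Real.exp_le_exp.2 (by linarith)

/-- A Brownian motion is indistinguishable from a process all of whose paths are continuous and
all of whose evaluations are measurable. -/
theorem ProbabilityTheory.IsBrownianReal.exists_continuous_measurable_version
    {b : ℝ≥0 → Ω → ℝ} (hb : IsBrownianReal b P) :
    ∃ b' : ℝ≥0 → Ω → ℝ, (∀ ω, Continuous fun s => b' s ω) ∧ (∀ s, Measurable (b' s)) ∧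
      ∀ᵐ ω ∂P, ∀ s, b s ω = b' s ω := by
  classical
  let d := TopologicalSpace.denseSeq ℝ≥0
  have hd : ∀ᵐ ω ∂P, ∀ n, b (d n) ω = (hb.aemeasurable (d n)).mk _ ω :=
    ae_all_iff.2 fun n => (hb.aemeasurable (d n)).ae_eq_mk
  -- On this measurable full set paths are continuous and agree with measurable versions at a dense
  -- sequence of times. Setting the process to 0 elsewhere makes every evaluation a limit of
  -- measurable ones.
  obtain ⟨S, hS, hSm, hSp⟩ := (hb.cont.and hd).exists_measurable_mem
  let b' : ℝ≥0 → Ω → ℝ := fun s ω => if ω ∈ S then b s ω else 0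
  have hcont : ∀ ω, Continuous fun s => b' s ω := fun ω => by
    by_cases hω : ω ∈ S
    · simpa only [b', hω, if_true] using (hSp ω hω).1
    · simpa only [b', hω, if_false] using continuous_const
  refine ⟨b', hcont, fun s => ?_, ?_⟩
  · have hdn : ∀ n, Measurable (b' (d n)) := fun n => by
      have : b' (d n) = S.indicator ((hb.aemeasurable (d n)).mk _) := by
        ext ω
        by_cases hω : ω ∈ S
        · simp only [b', hω, if_true, Set.indicator_of_mem, (hSp ω hω).2 n]
        · simp only [b', hω, if_false, not_false_eq_true, Set.indicator_of_notMem]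
      rw [this]
      exact (hb.aemeasurable (d n)).measurable_mk.indicator hSm
    obtain ⟨x, hx, hlim⟩ := mem_closure_iff_seq_limit.1
      ((TopologicalSpace.denseRange_denseSeq ℝ≥0).closure_range ▸ Set.mem_univ s)
    choose n hn using hx
    refine measurable_of_tendsto_metrizable (f := fun i => b' (x i)) (fun i => ?_) ?_
    · rw [← hn i]
      exact hdn (n i)
    · exact tendsto_pi_nhds.2 fun ω => ((hcont ω).tendsto s).comp hlim
  · filter_upwards [hS] with ω hω s
    simp only [b', if_pos hω]

end Brownian

/-! ### Fourier decay and the estimate for Brownian motion on the torus. -/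

section BrownianOnTorus

variable {Ω : Type*} [MeasurableSpace Ω] {P : Measure Ω} [IsProbabilityMeasure P]
  {b : ℝ≥0 → Ω → ℝ} {R : ℝ} [hR : Fact (0 < R)]

/-- Decay of the mixed Fourier coefficients of `(b t, r * b s)` under `ds ⊗ P`. -/
theorem norm_integral_fourier_brownian_le (hb : IsPreBrownianReal b P)
    (hcont : ∀ ω, Continuous fun s => b s ω) (hmeas : ∀ s, Measurable (b s))
    {r : ℝ} (hr : 0 < r) (t : ℝ≥0) (l k : ℤ) (hk : k ≠ 0) :
    ‖∫ a, (fourier l ((b t a.2 : ℝ) : AddCircle R) : ℂ) *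
        fourier k ((r * b a.1.toNNReal a.2 : ℝ) : AddCircle R)
        ∂((volume.restrict (Set.Ioc (0 : ℝ) t)).prod P)‖ ≤
      2 * R ^ 2 / (Real.pi ^ 2 * r ^ 2) * ((k : ℝ) ^ 2)⁻¹ := by
  have hR0 := hR.out
  have hpi := Real.pi_pos
  set u : ℝ := 2 * Real.pi * l / R with hu
  set v : ℝ := 2 * Real.pi * k * r / R with hv
  have hv0 : 0 < v ^ 2 := by
    have : (k : ℝ) ≠ 0 := by exact_mod_cast hk
    positivity
  have hjoint : Measurable fun a : ℝ × Ω => b a.1.toNNReal a.2 :=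
    (measurable_uncurry_of_continuous_of_measurable hcont hmeas).comp
      (measurable_real_toNNReal.prodMap measurable_id)
  have hf : ∀ a : ℝ × Ω, (fourier l ((b t a.2 : ℝ) : AddCircle R) : ℂ) *
        fourier k ((r * b a.1.toNNReal a.2 : ℝ) : AddCircle R) =
      Complex.exp (u * b t a.2 * Complex.I) *
        Complex.exp (v * b a.1.toNNReal a.2 * Complex.I) := fun a => by
    simp only [fourier_coe_apply, hu, hv]
    push_cast
    congr 2 <;> ring
  simp only [hf]
  have hexp : ∀ (c : ℝ) {g : ℝ × Ω → ℝ}, Measurable g →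
      Measurable fun a => Complex.exp (c * g a * Complex.I) := fun c g hg =>
    (Continuous.measurable (f := fun x : ℝ => Complex.exp (c * x * Complex.I))
      (by fun_prop)).comp hg
  have hn : ∀ c x : ℝ, ‖Complex.exp (c * x * Complex.I)‖ = 1 := fun c x => by
    rw [← Complex.ofReal_mul, Complex.norm_exp_ofReal_mul_I]
  have hint : Integrable (fun a : ℝ × Ω => Complex.exp (u * b t a.2 * Complex.I) *
      Complex.exp (v * b a.1.toNNReal a.2 * Complex.I))
      ((volume.restrict (Set.Ioc (0 : ℝ) t)).prod P) := by
    refine Integrable.of_bound ((hexp u ((hmeas t).comp measurable_snd)).mul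
      (hexp v hjoint)).aestronglyMeasurable 1 (ae_of_all _ fun a => ?_)
    rw [norm_mul, hn, hn, one_mul]
  rw [integral_prod _ hint]
  have hbound : ∀ᵐ s ∂(volume.restrict (Set.Ioc (0 : ℝ) t)),
      ‖∫ ω, Complex.exp (u * b t ω * Complex.I) *
        Complex.exp (v * b s.toNNReal ω * Complex.I) ∂P‖ ≤
      Real.exp (-(u ^ 2 / 2 * (t - s) + (u + v) ^ 2 / 2 * s)) := by
    filter_upwards [ae_restrict_mem measurableSet_Ioc] with s hs
    have hst : s.toNNReal ≤ t := Real.toNNReal_le_iff_le_coe.2 hs.2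
    rw [hb.norm_integral_exp hst, Real.coe_toNNReal s hs.1.le]
  refine (norm_integral_le_of_norm_le (Continuous.integrableOn_Ioc (by fun_prop)) hbound).trans ?_
  rw [← intervalIntegral.integral_of_le t.coe_nonneg]
  -- Otherwise |u| and |u+v| are both below |v|/2, contradicting the triangle inequality.
  have hm : v ^ 2 / 8 ≤ u ^ 2 / 2 ∨ v ^ 2 / 8 ≤ (u + v) ^ 2 / 2 := by
    by_contra! hcon
    nlinarith [sq_nonneg (2 * u + v)]
  refine (integral_exp_neg_add_le (by positivity) (by positivity) (by positivity)
    t.coe_nonneg hm).trans_eq ?_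
  rw [hv]
  field_simp
  norm_num

/-- The pairing estimate is applied on (0,t] × Ω and read back through Fubini. The rate r⁻² leaves
room for the factor r of the rescaled derivative. -/
theorem brownian_torus_estimate (hb : IsPreBrownianReal b P)
    (hcont : ∀ ω, Continuous fun s => b s ω) (hmeas : ∀ s, Measurable (b s))
    {f f' G G' : AddCircle R → ℝ} (hf : IsH1WithDeriv R f f') (hG : IsH1WithDeriv R G G')
    (hG0 : (∫ x, G x) = 0) {r : ℝ} (hr : 0 < r) {t : ℝ≥0} (ht : 0 < t) :
    (∀ᵐ ω ∂P, IntervalIntegrable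
      (fun s : ℝ => f' ((r * b s.toNNReal ω : ℝ) : AddCircle R)) volume 0 t) ∧
    Integrable (fun ω => G ((b t ω : ℝ) : AddCircle R) *
      (∫ s in (0 : ℝ)..t, f' ((r * b s.toNNReal ω : ℝ) : AddCircle R))) P ∧
    |∫ ω, (G ((b t ω : ℝ) : AddCircle R) *
      (∫ s in (0 : ℝ)..t, f' ((r * b s.toNNReal ω : ℝ) : AddCircle R))) ∂P| ≤
        2 * R / (3 * r ^ 2) * torusL2Norm R f * torusL2Norm R G' := by
  have hR0 := hR.out
  have hpi := Real.pi_pos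
  have hjoint : Measurable fun a : ℝ × Ω => b a.1.toNNReal a.2 :=
    (measurable_uncurry_of_continuous_of_measurable hcont hmeas).comp
      (measurable_real_toNNReal.prodMap measurable_id)
  -- Positivity of t makes the Gaussian law nondegenerate.
  have hbt : Measure.QuasiMeasurePreserving (b t) P volume :=
    ⟨hmeas t, (hb.hasLaw_eval t).map_eq ▸ gaussianReal_absolutelyContinuous 0 ht.ne'⟩
  have hX := (AddCircle.quasiMeasurePreserving_coe (R := R)).comp
    (hbt.comp (Measure.quasiMeasurePreserving_snd
      (μ := volume.restrict (Set.Ioc (0 : ℝ) t)) (ν := P)))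
  obtain ⟨h1, h2, h3⟩ := abs_integral_mul_le_of_fourier_decay
    (ν := (volume.restrict (Set.Ioc (0 : ℝ) t)).prod P)
    (X := fun a => ((b t a.2 : ℝ) : AddCircle R))
    (Y := fun a => ((r * b a.1.toNNReal a.2 : ℝ) : AddCircle R))
    hX.measurable (AddCircle.measurable_mk'.comp (hjoint.const_mul r)) hX.absolutelyContinuous
    (A := 2 * R ^ 2 / (Real.pi ^ 2 * r ^ 2)) (by positivity)
    (fun l k hk => norm_integral_fourier_brownian_le hb hcont hmeas hr t l k hk) hf hG hG0
  have e : ∀ ω, ∫ s in Set.Ioc (0 : ℝ) t, G ((b t ω : ℝ) : AddCircle R) *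
      f' ((r * b s.toNNReal ω : ℝ) : AddCircle R) = G ((b t ω : ℝ) : AddCircle R) *
      (∫ s in (0 : ℝ)..t, f' ((r * b s.toNNReal ω : ℝ) : AddCircle R)) := fun ω => by
    rw [integral_const_mul, intervalIntegral.integral_of_le t.coe_nonneg]
  refine ⟨?_, ?_, ?_⟩
  · filter_upwards [h1.prod_left_ae] with ω hω
    rw [intervalIntegrable_iff_integrableOn_Ioc_of_le t.coe_nonneg]
    exact hω
  · have := h2.integral_prod_right
    simpa only [e] using this
  · rw [integral_prod_symm _ h2] at h3
    simp only [e] at h3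
    refine h3.trans_eq ?_
    field_simp

end BrownianOnTorus

/-! ### Both inequalities for a general Brownian motion. -/

theorem mainTheorem5
    {Ω : Type*} [MeasurableSpace Ω] (P : Measure Ω) [IsProbabilityMeasure P]
    (b : ℝ≥0 → Ω → ℝ) (hb : IsBrownianReal b P)
    (R : ℝ) [Fact (0 < R)]
    (f f' G G' : AddCircle R → ℝ)
    (hf : IsH1WithDeriv R f f') (hG : IsH1WithDeriv R G G')
    (hf0 : (∫ x, f x) = 0) (hG0 : (∫ x, G x) = 0)
    (r : ℝ) (hr : 0 < r) (t : ℝ≥0) (ht : 0 < t) :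
    -- the time integral and the expectation are well defined
    (∀ᵐ ω ∂P, IntervalIntegrable
      (fun s : ℝ => f' ((r * b s.toNNReal ω : ℝ) : AddCircle R)) volume 0 t) ∧
    Integrable (fun ω => G ((b t ω : ℝ) : AddCircle R) *
      (∫ s in (0 : ℝ)..t, f' ((r * b s.toNNReal ω : ℝ) : AddCircle R))) P ∧
    -- the derivative of the function `x ↦ f (r x)`, evaluated at `b s`: all `r > 0`
    |∫ ω, (G ((b t ω : ℝ) : AddCircle R) *
      (∫ s in (0 : ℝ)..t, r * f' ((r * b s.toNNReal ω : ℝ) : AddCircle R))) ∂P| ≤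
        2 * R * r⁻¹ * torusL2Norm R f * torusL2Norm R G' ∧
    -- the derivative of `f`, evaluated at `r * b s`: all `r ≥ 1`
    (1 ≤ r →
      |∫ ω, (G ((b t ω : ℝ) : AddCircle R) *
        (∫ s in (0 : ℝ)..t, f' ((r * b s.toNNReal ω : ℝ) : AddCircle R))) ∂P| ≤
          2 * R * r⁻¹ * torusL2Norm R f * torusL2Norm R G') := by
  obtain ⟨b', hcont, hmeas, hbb⟩ := hb.exists_continuous_measurable_version
  have hb' : IsPreBrownianReal b' P := hb.toIsPreBrownianReal.congr fun s => by
    filter_upwards [hbb] with ω hω using hω s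
  obtain ⟨h1, h2, h3⟩ := brownian_torus_estimate hb' hcont hmeas hf hG hG0 hr ht
  have hae : (fun ω => G ((b t ω : ℝ) : AddCircle R) *
      (∫ s in (0 : ℝ)..t, f' ((r * b s.toNNReal ω : ℝ) : AddCircle R))) =ᵐ[P]
      fun ω => G ((b' t ω : ℝ) : AddCircle R) *
      (∫ s in (0 : ℝ)..t, f' ((r * b' s.toNNReal ω : ℝ) : AddCircle R)) := by
    filter_upwards [hbb] with ω hω
    simp only [hω]
  rw [← integral_congr_ae hae] at h3
  have hR : 0 < R := Fact.out
  have hN : 0 ≤ R * torusL2Norm R f * torusL2Norm R G' :=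
    mul_nonneg (mul_nonneg hR.le ENNReal.toReal_nonneg) ENNReal.toReal_nonneg
  -- This is (i) with r taken out of the integrals, and it implies (ii) when r ≥ 1; a factor 1/3 is
  -- discarded.
  have hmain : r * |∫ ω, (G ((b t ω : ℝ) : AddCircle R) *
      (∫ s in (0 : ℝ)..t, f' ((r * b s.toNNReal ω : ℝ) : AddCircle R))) ∂P| ≤
        2 * R * r⁻¹ * torusL2Norm R f * torusL2Norm R G' := by
    refine (mul_le_mul_of_nonneg_left h3 hr.le).trans ?_
    calc _ = 2 / 3 * r⁻¹ * (R * torusL2Norm R f * torusL2Norm R G') := by field_simp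
      _ ≤ 2 * r⁻¹ * (R * torusL2Norm R f * torusL2Norm R G') := by
          gcongr
          norm_num
      _ = _ := by ring
  refine ⟨?_, h2.congr hae.symm, ?_, fun hr1 => ?_⟩
  · filter_upwards [h1, hbb] with ω hω hω'
    simpa only [hω'] using hω
  · simp only [intervalIntegral.integral_const_mul, mul_left_comm _ r]
    rwa [integral_const_mul, abs_mul, abs_of_pos hr]
  · exact (le_mul_of_one_le_left (abs_nonneg _) hr1).trans hmain
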